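/- Let $q$ be a prime power and $n$ a positive integer with $\gcd(n,q)=1$. Let $m=\mathrm{ord}_n(q)$ be the multiplicative order of $q$ modulo $n$, and suppose that $q^{\lfloor m/2\rfloor}<n\le q^m-1$. Let $\delta$ be an integer with $$2\le\delta\le\delta_{\max}=\frac{n}{q^m-1}\bigl(q^{\lceil m/2\rceil}-1-(q-2)[m\text{ odd}]\bigr),$$ where $[m\text{ odd}]$ is $1$ if $m$ is odd and $0$ otherwise. For an integer $x$ let $S_x=\{xq^i\bmod n\mid i\ge 0\}\subseteq\mathbb Z/n$ be its $q$-cyclotomic coset. Fix a primitive $n$-th root of unity $\alpha$ in an extension field of $\mathbf F_q$. The cyclic code of length $n$ over $\mathbf F_q$ with defining set $Z\subseteq\mathbb Z/n$ (a union of cyclotomic cosets) is the set of all $c\in\mathbf F_q^n$ such that $\sum_{i=0}^{n-1}c_i\alpha^{zi}=0$ for all $z\in Z$. For $T\subseteq\mathbb Z/n$ write $T^{-1}=\{-t\mid t\in T\}$. Let $C_2$ be the cyclic code whose defining set $T_{C_2}$ is the union of those cosets among $S_0,S_1,\dots,S_{n-\delta}$ that differ from all of $S_{n-\delta+1},\dots,S_{n-1}$;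 that is, $T_{C_2}=(S_0\cup\dots\cup S_{n-\delta})\setminus(S_{n-\delta+1}\cup\dots\cup S_{n-1})$. Let $T$ be a nonempty union of cyclotomic cosets, each of which is either $\{0\}$ or one of $S_\delta,\dots,S_{n-\delta}$ and different from all of $S_1,\dots,S_{\delta-1}$ and $S_{n-\delta+1},\dots,S_{n-1}$. Let $C_1$ be the cyclic code with defining set $T_{C_2}\setminus(T\cup T^{-1})$. Put $k=m\lceil(\delta-1)(1-1/q)\rceil$ and $r=|T\cup T^{-1}|$. Then 1. $C_2\subseteq C_2^\perp$ and $C_1\cap C_1^\perp=C_2$, where $\perp$ is the Euclidean dual; 2. if $r<n-2k$, then there is a subsystem BCH code with parameters $[[n,n-2k-r,r,\ge\delta]]_q$, obtained from $C_1$ by the Euclidean construction. That is, there are a subspace $Q$ of $(\mathbb C^q)^{\otimes n}$ and an isometric decomposition $Q=A\otimes B$ with $\dim A=q^{n-2k-r}$ and $\dim B=q^r$ such that: - for some $d\ge\delta$, every error $E=X(a)Z(b)$ ($a,b\in\mathbf F_q^n$) that acts nontrivially on fewer than $d$ of the $n$ qudits is detected on the subsystem $A$, i.e. $PEP=1_A\otimes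 M_E$ on $Q$ for some operator $M_E$ on $B$, where $P$ is the orthogonal projection onto $Q$; - $Q$ is the space of vectors fixed by all $X(a)Z(b)$ with $a,b\in C_1\cap C_1^\perp$, and each $X(a)Z(b)$ with $a,b\in C_1$ maps $Q$ to itself and acts there as $1_A\otimes M$ for some operator $M$ on $B$. Here $X(a)|x\rangle=|x+a\rangle$ and $Z(b)|x\rangle=\omega^{\mathrm{tr}(b\cdot x)}|x\rangle$ for $x\in\mathbf F_q^n$, where $p$ is the prime dividing $q$, $\omega=e^{2\pi i/p}$ and $\mathrm{tr}$ is the trace from $\mathbf F_q$ to $\mathbf F_p$. -/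

import Mathlib

open scoped Matrix Kronecker

namespace SubsystemBCH

/-! ### Cyclotomic cosets and cyclic codes -/

/-- The `q`-cyclotomic coset `S_x = {x q^i mod n | i ≥ 0}` modulo `n`. -/
def cyclotomicCoset (q n : ℕ) (x : ZMod n) : Set (ZMod n) :=
  {y | ∃ i : ℕ, y = x * (q : ZMod n) ^ i}

/-- The union `S_a ∪ S_{a+1} ∪ ⋯ ∪ S_b` (empty if `b < a`). -/
def cosetUnion (q n a b : ℕ) : Set (ZMod n) :=
  {y | ∃ i : ℕ, a ≤ i ∧ i ≤ b ∧ y ∈ cyclotomicCoset q n (i : ZMod n)}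

/-- The cyclic code of length `n` over `F` with defining set `Z`, where `α` is a primitive `n`-th
root of unity in an extension field `L` of `F`: it consists of all words `c` whose polynomial
`c(X) = c_0 + c_1 X + ⋯ + c_{n-1} X^{n-1}` vanishes at `α^z` for every `z ∈ Z`. -/
def cyclicCode (F : Type*) {L : Type*} [Field F] [Field L] [Algebra F L] {n : ℕ} (α : L)
    (Z : Set (ZMod n)) : Submodule F (Fin n → F) where
  carrier := {c | ∀ z ∈ Z, ∑ i : Fin n, algebraMap F L (c i) * (α ^ z.val) ^ (i : ℕ) = 0}
  zero_mem' := by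
    intro z _
    simp
  add_mem' := by
    intro c d hc hd z hz
    have h1 := hc z hz
    have h2 := hd z hz
    simp only [Pi.add_apply, map_add, add_mul, Finset.sum_add_distrib]
    rw [h1, h2, add_zero]
  smul_mem' := by
    intro s c hc z hz
    have h1 := hc z hz
    simp only [Pi.smul_apply, smul_eq_mul, map_mul, mul_assoc, ← Finset.mul_sum]
    rw [h1, mul_zero]

/-- The Euclidean dual `C^⊥` of a linear code `C`. -/
def euclideanDual {F : Type*} [Field F] {n : ℕ} (C : Submodule F (Fin n → F)) :
    Submodule F (Fin n → F) where
  carrier := {x | ∀ c ∈ C, c ⬝ᵥ x = 0}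
  zero_mem' := by
    intro c _
    simp
  add_mem' := by
    intro x y hx hy c hc
    rw [dotProduct_add, hx c hc, hy c hc, add_zero]
  smul_mem' := by
    intro s x hx c hc
    rw [dotProduct_smul, hx c hc, smul_zero]

/-! ### Errors on `n` qudits

The state space `(ℂ^q)^{⊗ n}` has the orthonormal basis `|x⟩`, `x ∈ F^n`; operators on it are
matrices indexed by `Fin n → F`. -/

/-- The operator `X(a)|x⟩ = |x + a⟩` on `ℂ^q`. -/
def shiftOp {F : Type*} [Field F] [DecidableEq F] (a : F) : Matrix F F ℂ :=
  Matrix.of fun y x => if y = x + a then 1 else 0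

/-- The operator `Z(b)|x⟩ = ω^{tr(bx)}|x⟩` on `ℂ^q`, where `ω = exp(2πi/p)` and `tr` is the trace
from `F` to `ZMod p`. -/
noncomputable def phaseOp (p : ℕ) [Fact p.Prime] {F : Type*} [Field F] [DecidableEq F]
    [Algebra (ZMod p) F] (b : F) : Matrix F F ℂ :=
  Matrix.diagonal fun x => ZMod.stdAddChar (N := p) (Algebra.trace (ZMod p) F (b * x))

/-- The tensor product `M_1 ⊗ ⋯ ⊗ M_n` of operators on `ℂ^q`. -/
def tensorOp {F : Type*} {n : ℕ} (M : Fin n → Matrix F F ℂ) :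
    Matrix (Fin n → F) (Fin n → F) ℂ :=
  Matrix.of fun y x => ∏ i, M i (y i) (x i)

/-- The error `X(a) Z(b)` for `a, b ∈ F^n`. -/
noncomputable def errorOp (p : ℕ) [Fact p.Prime] {F : Type*} [Field F] [Fintype F] [DecidableEq F]
    [Algebra (ZMod p) F] {n : ℕ} (a b : Fin n → F) : Matrix (Fin n → F) (Fin n → F) ℂ :=
  tensorOp fun i => shiftOp (a i) * phaseOp p (b i)

/-- The weight of the error `X(a) Z(b)`: the number of qudits on which it acts nontrivially. -/
def symplecticWeight {F : Type*} [Field F] [DecidableEq F] {n : ℕ} (a b : Fin n → F) : ℕ :=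
  hammingNorm fun i => (a i, b i)

/-! ### Subsystem codes -/

/-- A subspace `Q = A ⊗ B` of `(ℂ^q)^{⊗ n}` with `dim A = q^k` and `dim B = q^r` is given by an
isometry `V` from `ℂ^{q^k} ⊗ ℂ^{q^r}` onto `Q`. It is an `[[n,k,r,d]]_q` subsystem code if every
error `E` of weight less than `d` is detected on the subsystem `A`, that is, compressing `E`
to `Q` gives an operator `1_A ⊗ M` with some operator `M` on `B`. -/
structure IsSubsystemCode (p : ℕ) [Fact p.Prime] {F : Type*} [Field F] [Fintype F] [DecidableEq F]
    [Algebra (ZMod p) F] (n k r d : ℕ)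
    (V : Matrix (Fin n → F) (Fin (Fintype.card F ^ k) × Fin (Fintype.card F ^ r)) ℂ) : Prop where
  isometry : Vᴴ * V = 1
  detects : ∀ a b : Fin n → F, symplecticWeight a b < d →
    ∃ M : Matrix (Fin (Fintype.card F ^ r)) (Fin (Fintype.card F ^ r)) ℂ,
      Vᴴ * errorOp p a b * V =
        (1 : Matrix (Fin (Fintype.card F ^ k)) (Fin (Fintype.card F ^ k)) ℂ) ⊗ₖ M

/-- The subsystem code `Q = A ⊗ B` given by `V` arises from the classical code `C` by the
Euclidean construction: `Q` is the space stabilized by all `X(a) Z(b)` with `a, b ∈ C ∩ C^⊥`,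
and the `X(a) Z(b)` with `a, b ∈ C` map `Q` to itself and act on the subsystem `B` only. -/
structure IsEuclideanConstruction (p : ℕ) [Fact p.Prime] {F : Type*} [Field F] [Fintype F]
    [DecidableEq F] [Algebra (ZMod p) F] {n k r : ℕ} (C : Submodule F (Fin n → F))
    (V : Matrix (Fin n → F) (Fin (Fintype.card F ^ k) × Fin (Fintype.card F ^ r)) ℂ) : Prop where
  stabilizer : ∀ ψ : (Fin n → F) → ℂ, (∃ φ, ψ = V *ᵥ φ) ↔
    ∀ a ∈ C ⊓ euclideanDual C, ∀ b ∈ C ⊓ euclideanDual C, errorOp p a b *ᵥ ψ = ψ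
  gauge : ∀ a ∈ C, ∀ b ∈ C,
    ∃ M : Matrix (Fin (Fintype.card F ^ r)) (Fin (Fintype.card F ^ r)) ℂ,
      errorOp p a b * V =
        V * ((1 : Matrix (Fin (Fintype.card F ^ k)) (Fin (Fintype.card F ^ k)) ℂ) ⊗ₖ M)

end SubsystemBCH

/-! Let `U` be the union of the cosets of `n-δ+1, …, n-1`, so that `-U` is the union of those of `1,
…, δ-1`. The defining set of `C₂` is the complement of `U`. The bound on `δ` makes `U` and `-U`
disjoint (`natCast_mul_pow_ne_neg`) and gives `|U| = k` (`ncard_cosetUnion_one`).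

The dual of the cyclic code with defining set `Z` has defining set `{z | -z ∉ Z}`
(`finrank_cyclicCode_and_euclideanDual`). Hence `C₂^⊥` has defining set `-U`, contains `C₂`, and has
distance at least `δ` by the BCH bound. The set `S = T ∪ -T` is symmetric and disjoint from `U`;
`C₁` and `C₁^⊥` have defining sets `(U ∪ S)ᶜ` and `-U ∪ S`, with union `Uᶜ`, so they intersect in
`C₂`.

For the quantum part put `R = C₁ ∩ C₁^⊥`. The uniform superpositions over the cosets of `R` in `R^⊥
= C₁ + C₁^⊥` form an orthonormal basis of the stabilized space, and `R^⊥/R = C₁^⊥/R ⊕ C₁/R` splits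
this space as `A ⊗ B`. An error with `a` or `b` outside `R^⊥` compresses to zero; if both lie in
`R^⊥` and the weight is below `δ`, the error is trivial. -/

namespace SubsystemBCH

open Polynomial

/-! ### Euclidean duals -/

section Dual

variable {F : Type*} [Field F] {n : ℕ}

theorem mem_euclideanDual {C : Submodule F (Fin n → F)} {x : Fin n → F} :
    x ∈ euclideanDual C ↔ ∀ c ∈ C, c ⬝ᵥ x = 0 := Iff.rfl

theorem finrank_euclideanDual (C : Submodule F (Fin n → F)) :
    Module.finrank F (euclideanDual C) = n - Module.finrank F C := by
  have hB : (Matrix.toBilin' (1 : Matrix (Fin n) (Fin n) F)).Nondegenerate :=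
    LinearMap.BilinForm.nondegenerate_toBilin'_of_det_ne_zero' _ (by simp)
  have h : euclideanDual C = (Matrix.toBilin' (1 : Matrix (Fin n) (Fin n) F)).orthogonal C := by
    ext x
    simp [mem_euclideanDual, LinearMap.BilinForm.mem_orthogonal_iff,
      Matrix.toBilin'_apply']
  rw [h, LinearMap.BilinForm.finrank_orthogonal hB]
  simp

theorem finrank_le_length (C : Submodule F (Fin n → F)) : Module.finrank F C ≤ n := by
  simpa using Submodule.finrank_le C

/-- The dual of the radical `C ∩ C^⊥` is `C + C^⊥`. -/
theorem euclideanDual_inf_euclideanDual (C : Submodule F (Fin n → F)) :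
    euclideanDual (C ⊓ euclideanDual C) = C ⊔ euclideanDual C := by
  symm
  apply Submodule.eq_of_le_of_finrank_eq
  · refine sup_le (fun x hx c hc => ?_) (fun x hx c hc => hx c hc.1)
    rw [dotProduct_comm]
    exact hc.2 x hx
  -- The dimensions of `C + C^⊥` and `C ∩ C^⊥` add up to `dim C + (n - dim C) = n`.
  · have h1 := Submodule.finrank_sup_add_finrank_inf_eq C (euclideanDual C)
    have h2 := finrank_le_length C
    rw [finrank_euclideanDual] at h1 ⊢
    omega

end Dual

/-! ### Cyclic codes -/

section Cyclic

variable {F L : Type*} [Field F] [Field L] [Algebra F L] {n : ℕ}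

theorem mem_cyclicCode {α : L} {Z : Set (ZMod n)} {c : Fin n → F} :
    c ∈ cyclicCode F α Z ↔
      ∀ z ∈ Z, ∑ i : Fin n, algebraMap F L (c i) * (α ^ z.val) ^ (i : ℕ) = 0 := Iff.rfl

theorem cyclicCode_anti (α : L) {Y Z : Set (ZMod n)} (h : Y ⊆ Z) :
    cyclicCode F α Z ≤ cyclicCode F α Y := fun _ hc z hz => hc z (h hz)

theorem cyclicCode_inf (α : L) (Y Z : Set (ZMod n)) :
    cyclicCode F α Y ⊓ cyclicCode F α Z = cyclicCode F α (Y ∪ Z) := by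
  ext c
  simp only [Submodule.mem_inf, mem_cyclicCode, Set.mem_union]
  exact ⟨fun h z hz => hz.elim (h.1 z) (h.2 z),
    fun h => ⟨fun z hz => h z (Or.inl hz), fun z hz => h z (Or.inr hz)⟩⟩

/-- `X^q - X` has at most `q` roots in `L`, and the image of `F` already supplies `q` of them. -/
theorem mem_range_algebraMap_of_pow_card [Fintype F] {x : L} (hx : x ^ Fintype.card F = x) :
    x ∈ Set.range (algebraMap F L) := by
  classical
  have hne : (X ^ Fintype.card F - X : L[X]) ≠ 0 :=
    FiniteField.X_pow_card_sub_X_ne_zero L Fintype.one_lt_card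
  have hsub : Finset.univ.image (algebraMap F L) ⊆ (X ^ Fintype.card F - X : L[X]).roots.toFinset := by
    intro y hy
    obtain ⟨a, -, rfl⟩ := Finset.mem_image.mp hy
    rw [Multiset.mem_toFinset, mem_roots hne]
    simp [IsRoot, ← map_pow, FiniteField.pow_card]
  have hcard : (X ^ Fintype.card F - X : L[X]).roots.toFinset.card ≤
      (Finset.univ.image (algebraMap F L)).card := by
    rw [Finset.card_image_of_injective _ (algebraMap F L).injective, Finset.card_univ]
    refine (Multiset.toFinset_card_le _).trans ((card_roots' _).trans ?_)
    rw [FiniteField.X_pow_card_sub_X_natDegree_eq L Fintype.one_lt_card]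
  have hmem : x ∈ (X ^ Fintype.card F - X : L[X]).roots.toFinset := by
    rw [Multiset.mem_toFinset, mem_roots hne]
    simp [IsRoot, hx]
  rw [← Finset.eq_of_subset_of_card_le hsub hcard] at hmem
  obtain ⟨a, -, rfl⟩ := Finset.mem_image.mp hmem
  exact ⟨a, rfl⟩

theorem mem_lifts_of_map_pow_card [Fintype F] (p : L[X])
    (hp : ∀ i, p.coeff i ^ Fintype.card F = p.coeff i) : p ∈ lifts (algebraMap F L) :=
  (lifts_iff_coeff_lifts p).2 fun i => mem_range_algebraMap_of_pow_card (hp i)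

theorem pow_val_natCast [NeZero n] {α : L} (hα : IsPrimitiveRoot α n) (i : ℕ) :
    α ^ (i : ZMod n).val = α ^ i := by
  rw [← AddChar.zmodChar_apply hα.pow_eq_one, AddChar.zmodChar_apply' hα.pow_eq_one]

theorem pow_val_mul_natCast [NeZero n] {α : L} (hα : IsPrimitiveRoot α n) (z : ZMod n) (q : ℕ) :
    α ^ (z * (q : ZMod n)).val = (α ^ z.val) ^ q := by
  rw [← pow_mul, ← pow_val_natCast hα (z.val * q)]
  simp

/-- The polynomial with simple roots `α^z`, `z ∈ Z`, is defined over `F` if `Z` is a union of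
cyclotomic cosets. -/
theorem exists_map_eq_prod_X_sub_C [Fintype F] [NeZero n] {α : L} (hα : IsPrimitiveRoot α n)
    (hq : IsUnit ((Fintype.card F : ℕ) : ZMod n)) (Z : Finset (ZMod n))
    (hZ : ∀ z ∈ Z, z * ((Fintype.card F : ℕ) : ZMod n) ∈ Z) :
    ∃ g : F[X], g.map (algebraMap F L) = ∏ z ∈ Z, (X - C (α ^ z.val)) := by
  classical
  set P : L[X] := ∏ z ∈ Z, (X - C (α ^ z.val)) with hP
  obtain ⟨p, hp⟩ := CharP.exists F
  obtain ⟨e, hpp, he⟩ := FiniteField.card F p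
  have : Fact p.Prime := ⟨hpp⟩
  have : CharP L p := charP_of_injective_algebraMap (algebraMap F L).injective p
  -- Frobenius sends `α^z` to `α^(zq)`, and `z ↦ zq` is an injective self-map of the finite set `Z`,
  -- hence permutes the roots.
  have hfrob : P.map (iterateFrobenius L p e) = P := by
    have hperm : Z.image (fun z => z * ((Fintype.card F : ℕ) : ZMod n)) = Z := by
      refine Finset.eq_of_subset_of_card_le (Finset.image_subset_iff.2 hZ) ?_
      rw [Finset.card_image_of_injective _ fun a b h => hq.mul_left_injective h]
    rw [hP, Polynomial.map_prod]
    conv_rhs => rw [← hperm, Finset.prod_image fun a _ b _ h => hq.mul_left_injective h]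
    refine Finset.prod_congr rfl fun z _ => ?_
    rw [pow_val_mul_natCast hα, Polynomial.map_sub, map_X, map_C, iterateFrobenius_def, he]
  have hl : P ∈ lifts (algebraMap F L) := by
    refine mem_lifts_of_map_pow_card P fun i => ?_
    conv_rhs => rw [← hfrob]
    rw [coeff_map, iterateFrobenius_def, he]
  obtain ⟨g, hg⟩ := hl
  exact ⟨g, hg⟩

/-- The multiples `g * h` of the generator polynomial with `deg h < n - |Z|` are distinct codewords.
-/
theorem le_finrank_cyclicCode [Fintype F] [NeZero n] {α : L} (hα : IsPrimitiveRoot α n)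
    (hq : IsUnit ((Fintype.card F : ℕ) : ZMod n)) (Z : Set (ZMod n))
    (hZ : ∀ z ∈ Z, z * ((Fintype.card F : ℕ) : ZMod n) ∈ Z) :
    n - Z.ncard ≤ Module.finrank F (cyclicCode F α Z) := by
  classical
  obtain ⟨g, hg⟩ := exists_map_eq_prod_X_sub_C hα hq Z.toFinite.toFinset (by simpa using hZ)
  have hmonic : g.Monic := by
    rw [← Polynomial.monic_map_iff (f := algebraMap F L), hg]
    exact monic_prod_X_sub_C _ _
  have hdeg : g.natDegree = Z.ncard := by
    rw [← natDegree_map (algebraMap F L), hg, natDegree_prod_of_monic _ _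
      fun _ _ => monic_X_sub_C _]
    simp only [natDegree_X_sub_C, Finset.sum_const, smul_eq_mul, mul_one]
    exact (Set.ncard_eq_toFinset_card Z _).symm
  have hle : Z.ncard ≤ n := by
    simpa [Set.ncard_univ] using Set.ncard_le_ncard (Set.subset_univ Z)
  have hlt : ∀ h : degreeLT F (n - Z.ncard), g * (h : F[X]) ∈ degreeLT F n := by
    rintro ⟨h, hh⟩
    rw [mem_degreeLT] at hh ⊢
    rcases eq_or_ne h 0 with rfl | h0
    · simp
    · rw [degree_eq_natDegree h0, Nat.cast_lt] at hh
      rw [degree_eq_natDegree (mul_ne_zero hmonic.ne_zero h0), Nat.cast_lt,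
        natDegree_mul hmonic.ne_zero h0, hdeg]
      omega
  let φ : degreeLT F (n - Z.ncard) →ₗ[F] (Fin n → F) :=
    (degreeLTEquiv F n).toLinearMap ∘ₗ
      ((LinearMap.mulLeft F g).comp (Submodule.subtype _)).codRestrict (degreeLT F n) hlt
  have hφ : ∀ h, φ h ∈ cyclicCode F α Z := by
    intro h z hz
    have h1 : ∑ i : Fin n, algebraMap F L (φ h i) * (α ^ z.val) ^ (i : ℕ) =
        aeval (α ^ z.val) (g * (h : F[X])) := by
      rw [aeval_eq_sum_range' (n := n)]
      · rw [← Fin.sum_univ_eq_sum_range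
          (fun i => (g * (h : F[X])).coeff i • (α ^ z.val) ^ i)]
        refine Finset.sum_congr rfl fun i _ => ?_
        rw [Algebra.smul_def]
        rfl
      · by_cases h0 : g * (h : F[X]) = 0
        · rw [h0]; simpa using NeZero.pos n
        · exact (natDegree_lt_iff_degree_lt h0).2 (mem_degreeLT.1 (hlt h))
    rw [h1, map_mul, ← eval_map_algebraMap, hg, eval_prod, Finset.prod_eq_zero (i := z), zero_mul]
    · simpa using hz
    · simp
  have hinj : Function.Injective (φ.codRestrict _ hφ) := by
    rw [← LinearMap.ker_eq_bot, LinearMap.ker_codRestrict, LinearMap.ker_eq_bot]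
    refine (degreeLTEquiv F n).injective.comp ?_
    intro a b hab
    have := congrArg Subtype.val hab
    exact Subtype.ext (mul_left_cancel₀ hmonic.ne_zero this)
  have := LinearMap.finrank_le_finrank_of_injective hinj
  rwa [LinearEquiv.finrank_eq (degreeLTEquiv F _), Module.finrank_fin_fun] at this

theorem sum_pow_val_mul_pow_val_neg [NeZero n] {α : L} (hα : IsPrimitiveRoot α n) (i j : Fin n) :
    ∑ z : ZMod n, (α ^ z.val) ^ (i : ℕ) * (α ^ (-z).val) ^ (j : ℕ) =
      if i = j then (n : L) else 0 := by
  classical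
  have h := AddChar.sum_mulShift (((i : ℕ) : ZMod n) - ((j : ℕ) : ZMod n))
    (AddChar.zmodChar_primitive_of_primitive_root n hα)
  simp only [ZMod.card, sub_eq_zero, ZMod.natCast_eq_natCast_iff', Nat.mod_eq_of_lt i.2,
    Nat.mod_eq_of_lt j.2, ← Fin.ext_iff, Nat.cast_ite, Nat.cast_zero] at h
  rw [← h]
  refine Finset.sum_congr rfl fun z _ => ?_
  rw [← AddChar.zmodChar_apply hα.pow_eq_one, ← AddChar.zmodChar_apply hα.pow_eq_one,
    ← AddChar.map_nsmul_eq_pow, ← AddChar.map_nsmul_eq_pow, ← AddChar.map_add_eq_mul]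
  congr 1
  simp only [nsmul_eq_mul]
  ring

/-- Parseval: `n (c · d) = ∑ z, ĉ(z) d̂(-z)`, where one factor of every term vanishes. A primitive
`n`-th root of unity in `L` forces `n ≠ 0` there. -/
theorem cyclicCode_le_euclideanDual [NeZero n] {α : L} (hα : IsPrimitiveRoot α n)
    (Z : Set (ZMod n)) :
    cyclicCode F α {z | -z ∉ Z} ≤ euclideanDual (cyclicCode F α Z) := by
  intro d hd c hc
  have hn : (n : L) ≠ 0 := (hα.neZero').out
  apply (algebraMap F L).injective
  rw [map_zero]
  refine (mul_eq_zero.1 ?_).resolve_left hn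
  calc (n : L) * algebraMap F L (c ⬝ᵥ d)
      = ∑ i : Fin n, ∑ j : Fin n, algebraMap F L (c i) * algebraMap F L (d j) *
          (if i = j then (n : L) else 0) := by
        simp only [dotProduct, map_sum, map_mul, Finset.mul_sum, mul_ite, mul_zero,
          Finset.sum_ite_eq, Finset.mem_univ, if_true]
        exact Finset.sum_congr rfl fun i _ => by ring
    _ = ∑ z : ZMod n, (∑ i : Fin n, algebraMap F L (c i) * (α ^ z.val) ^ (i : ℕ)) *
          ∑ j : Fin n, algebraMap F L (d j) * (α ^ (-z).val) ^ (j : ℕ) := by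
        simp only [← sum_pow_val_mul_pow_val_neg hα, Finset.sum_mul_sum]
        simp only [Finset.mul_sum]
        rw [Finset.sum_comm (s := (Finset.univ : Finset (ZMod n)))]
        refine Finset.sum_congr rfl fun i _ => ?_
        rw [Finset.sum_comm]
        exact Finset.sum_congr rfl fun z _ => Finset.sum_congr rfl fun j _ => by ring
    _ = 0 := by
        refine Finset.sum_eq_zero fun z _ => ?_
        by_cases hz : z ∈ Z
        · rw [hc z hz, zero_mul]
        · rw [hd (-z) (by simpa using hz), mul_zero]

/-- The lower bounds `n - |Z|` and `|Z|` for the dimensions of the two codes, combined with the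
inclusion in a dual of dimension `n - dim`, squeeze everything to equality. -/
theorem finrank_cyclicCode_and_euclideanDual [Fintype F] [NeZero n] {α : L}
    (hα : IsPrimitiveRoot α n)
    (hq : IsUnit ((Fintype.card F : ℕ) : ZMod n)) (Z : Set (ZMod n))
    (hZ : ∀ z, z * ((Fintype.card F : ℕ) : ZMod n) ∈ Z ↔ z ∈ Z) :
    Module.finrank F (cyclicCode F α Z) = n - Z.ncard ∧
      euclideanDual (cyclicCode F α Z) = cyclicCode F α {z | -z ∉ Z} := by
  have h1 := le_finrank_cyclicCode hα hq Z fun z hz => (hZ z).2 hz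
  have h2 := le_finrank_cyclicCode hα hq {z | -z ∉ Z} (by
    intro z hz
    show -(z * _) ∉ Z
    rwa [← neg_mul, hZ])
  have h3 := cyclicCode_le_euclideanDual (F := F) hα Z
  have h4 := Submodule.finrank_mono h3
  have h5 : {z : ZMod n | -z ∉ Z}.ncard = n - Z.ncard := by
    have : {z : ZMod n | -z ∉ Z} = (fun z => -z) '' Zᶜ := by
      ext z; simp
    rw [this, Set.ncard_image_of_injective _ neg_injective, Set.ncard_compl, Nat.card_zmod]
  have h6 : Z.ncard ≤ n := by
    simpa [Set.ncard_univ] using Set.ncard_le_ncard (Set.subset_univ Z)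
  have h7 := finrank_le_length (cyclicCode F α Z)
  have h8 := finrank_euclideanDual (cyclicCode F α Z)
  rw [h5] at h2
  exact ⟨by omega, (Submodule.eq_of_le_of_finrank_le h3 (by omega)).symm⟩

/-- The BCH bound. -/
theorem le_hammingNorm_of_mem_cyclicCode [DecidableEq F] [NeZero n] {α : L}
    (hα : IsPrimitiveRoot α n) {Z : Set (ZMod n)} {δ : ℕ}
    (hZ : ∀ i : ℕ, 1 ≤ i → i < δ → (i : ZMod n) ∈ Z) {c : Fin n → F} (hc : c ∈ cyclicCode F α Z)
    (hc0 : c ≠ 0) : δ ≤ hammingNorm c := by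
  classical
  by_contra! hlt
  obtain ⟨i₀, hi₀⟩ := Function.ne_iff.1 hc0
  set s : Finset (Fin n) := Finset.univ.filter fun i => c i ≠ 0 with hs
  have hi₀s : i₀ ∈ s := by simpa [hs] using hi₀
  have hscard : s.card < δ := hlt
  have hpow : ∀ l < δ - 1, ∑ i : Fin n, algebraMap F L (c i) * α ^ (i : ℕ) *
      (α ^ (i : ℕ)) ^ l = 0 := by
    intro l hl
    rw [← hc _ (hZ (l + 1) (by omega) (by omega))]
    refine Finset.sum_congr rfl fun i _ => ?_
    rw [pow_val_natCast hα]
    ring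
  -- This replaces the Vandermonde determinant: testing against the polynomial that vanishes at all
  -- support points except `i₀` isolates the single term at `i₀`.
  have hpoly : ∀ P : L[X], P.natDegree < δ - 1 →
      ∑ i : Fin n, algebraMap F L (c i) * α ^ (i : ℕ) * P.eval (α ^ (i : ℕ)) = 0 := by
    intro P hP
    simp only [eval_eq_sum_range' hP, Finset.mul_sum]
    rw [Finset.sum_comm]
    refine Finset.sum_eq_zero fun l hl => ?_
    have := hpow l (Finset.mem_range.1 hl)
    calc _ = P.coeff l * ∑ i : Fin n, algebraMap F L (c i) * α ^ (i : ℕ) *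
            (α ^ (i : ℕ)) ^ l := by
          rw [Finset.mul_sum]
          exact Finset.sum_congr rfl fun i _ => by ring
      _ = 0 := by rw [this, mul_zero]
  have hdeg : (∏ i ∈ s.erase i₀, (X - C (α ^ (i : ℕ))) : L[X]).natDegree < δ - 1 := by
    rw [natDegree_prod_of_monic _ _ fun _ _ => monic_X_sub_C _]
    have := Finset.card_pos.2 ⟨i₀, hi₀s⟩
    simp only [natDegree_X_sub_C, Finset.sum_const, smul_eq_mul, mul_one,
      Finset.card_erase_of_mem hi₀s]
    omega
  have h0 := hpoly _ hdeg
  rw [Finset.sum_eq_single i₀] at h0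
  · simp only [eval_prod, eval_sub, eval_X, eval_C, mul_eq_zero, Finset.prod_eq_zero_iff,
      sub_eq_zero] at h0
    rcases h0 with (h0 | h0) | ⟨j, hj, h0⟩
    · exact hi₀ (by simpa using h0)
    · exact hα.ne_zero (NeZero.ne n) (eq_zero_of_pow_eq_zero h0)
    · exact (Finset.mem_erase.1 hj).1 (Fin.ext (hα.pow_inj i₀.2 j.2 h0)).symm
  · intro j _ hj
    by_cases hjs : j ∈ s
    · rw [eval_prod, Finset.prod_eq_zero (Finset.mem_erase.2 ⟨hj, hjs⟩) (by simp), mul_zero]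
    · have : c j = 0 := by simpa [hs] using hjs
      simp [this]
  · simp

end Cyclic

/-! ### Cyclotomic cosets of small numbers -/

section Arithmetic

/-- The largest admissible value of `δ (q^m - 1) / n`. -/
def designBound (q m : ℕ) : ℕ := q ^ ((m + 1) / 2) - 1 - (if Odd m then q - 2 else 0)

/-- The extreme case is `j = h = ⌊m/2⌋`. For even `m`, `(q^h - 2)(q^h + 1) < q^m - 1`; for odd `m`,
`(q^(h+1) - q)(q^h + 1) = q^m - q`, which is why `q - 2` is subtracted in `designBound`. -/
theorem mul_pow_lt {q m j X : ℕ} (hq : 2 ≤ q) (hj : j ≤ m / 2) (hX : X < designBound q m) :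
    X * (q ^ j + 1) < q ^ m - 1 := by
  have hle : q ^ j ≤ q ^ (m / 2) := Nat.pow_le_pow_right (by omega) hj
  have h1 : X * (q ^ j + 1) ≤ X * (q ^ (m / 2) + 1) := Nat.mul_le_mul_left _ (by omega)
  refine h1.trans_lt ?_
  rcases Nat.even_or_odd' m with ⟨h, rfl | rfl⟩
  · have e1 : (2 * h + 1) / 2 = h := by omega
    have e2 : 2 * h / 2 = h := by omega
    have e3 : ¬ Odd (2 * h) := by simp
    simp only [designBound, e1, e3, if_false] at hX
    rw [e2]
    have e4 : q ^ (2 * h) = q ^ h * q ^ h := by rw [two_mul, pow_add]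
    generalize q ^ h = a at *
    obtain ⟨b, rfl⟩ : ∃ b, a = b + 1 + X + 1 := ⟨a - 1 - X - 1, by omega⟩
    rw [e4]
    apply Nat.lt_sub_of_add_lt
    nlinarith
  · have e1 : (2 * h + 1 + 1) / 2 = h + 1 := by omega
    have e2 : (2 * h + 1) / 2 = h := by omega
    have e3 : Odd (2 * h + 1) := by simp
    simp only [designBound, e1, e3, if_true] at hX
    rw [e2]
    have e4 : q ^ (2 * h + 1) = q ^ h * q ^ h * q := by rw [pow_succ, two_mul, pow_add]
    have e5 : q ^ (h + 1) = q ^ h * q := pow_succ _ _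
    rw [e5] at hX
    have e6 : 1 ≤ q ^ h := Nat.one_le_pow _ _ (by omega)
    rw [e4]
    generalize q ^ h = a at *
    have hX' : X + q ≤ a * q := by
      have := Nat.mul_le_mul_right q e6
      omega
    apply Nat.lt_sub_of_add_lt
    nlinarith

variable {q n m e : ℕ}

theorem natCast_pow_mod [NeZero m] (hm : (q : ZMod n) ^ m = 1) (j : ℕ) :
    (q : ZMod n) ^ (j % m) = (q : ZMod n) ^ j := by
  conv_rhs => rw [← Nat.mod_add_div j m, pow_add, pow_mul, hm, one_pow, mul_one]

/-- The numbers `x` and `-y` are in different cyclotomic cosets if `x` and `y` are small. -/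
theorem natCast_mul_pow_ne_neg (hq : 2 ≤ q) (hm : (q : ZMod n) ^ m = 1) (hm0 : 0 < m)
    (he : n * e = q ^ m - 1) {x y : ℕ} (hx0 : 0 < x) (hy0 : 0 < y)
    (hx : e * x < designBound q m) (hy : e * y < designBound q m) (j : ℕ) :
    (x : ZMod n) * (q : ZMod n) ^ j ≠ -(y : ZMod n) := by
  have : NeZero m := ⟨hm0.ne'⟩
  have key : ∀ {x y : ℕ}, 0 < x → 0 < y → e * x < designBound q m → e * y < designBound q m →
      ∀ j ≤ m / 2, (x : ZMod n) * (q : ZMod n) ^ j ≠ -(y : ZMod n) := by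
    intro x y hx0 hy0 hx hy j hj h
    rw [eq_neg_iff_add_eq_zero] at h
    have h' : ((x * q ^ j + y : ℕ) : ZMod n) = 0 := by push_cast; exact h
    rw [ZMod.natCast_eq_zero_iff] at h'
    -- Scaling by `e = (q^m - 1)/n` turns the divisibility by `n` into one by `q^m - 1`, too large
    -- to divide the positive number on the right.
    have h2 : q ^ m - 1 ∣ e * (x * q ^ j + y) := by
      rw [← he, mul_comm n e]
      exact Nat.mul_dvd_mul_left _ h'
    have he0 : 0 < e := by
      rcases Nat.eq_zero_or_pos e with rfl | h
      · have := Nat.one_lt_pow hm0.ne' (show 1 < q by omega)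
        omega
      · exact h
    have h3 := Nat.le_of_dvd (by positivity) h2
    have h4 : e * (x * q ^ j + y) ≤ max (e * x) (e * y) * (q ^ j + 1) := by
      calc e * (x * q ^ j + y) = e * x * q ^ j + e * y := by ring
        _ ≤ max (e * x) (e * y) * q ^ j + max (e * x) (e * y) :=
          Nat.add_le_add (Nat.mul_le_mul_right _ (le_max_left _ _)) (le_max_right _ _)
        _ = _ := by ring
    have := mul_pow_lt hq hj (max_lt hx hy)
    omega
  intro h
  rw [← natCast_pow_mod hm] at h
  have hlt := Nat.mod_lt j hm0
  rcases le_or_gt (j % m) (m / 2) with hj | hj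
  · exact key hx0 hy0 hx hy _ hj h
  -- Multiplying by `q^(m-j)` swaps the roles of `x` and `y` and makes the exponent small.
  · refine key hy0 hx0 hy hx (m - j % m) (by omega) ?_
    rw [← neg_eq_iff_eq_neg.2 h, neg_mul, mul_assoc, ← pow_add,
      Nat.add_sub_cancel' hlt.le, hm, mul_one]

/-- For exponents up to `m/2` both sides are below `n`, so the congruence is an equality of integers
and `q ∤ y` forces exponent zero. Thus small numbers prime to divisibility by `q` have distinct
cosets of full size `m`. -/
theorem natCast_mul_pow_eq (hq : 2 ≤ q) (hm : (q : ZMod n) ^ m = 1) (hm0 : 0 < m)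
    (he : n * e = q ^ m - 1) {x y : ℕ}
    (hx : e * x < designBound q m) (hy : e * y < designBound q m) (hxq : ¬ q ∣ x) (hyq : ¬ q ∣ y)
    {j : ℕ} (h : (x : ZMod n) * (q : ZMod n) ^ j = (y : ZMod n)) : m ∣ j ∧ x = y := by
  have : NeZero m := ⟨hm0.ne'⟩
  have he0 : 0 < e := by
    rcases Nat.eq_zero_or_pos e with rfl | h
    · have := Nat.one_lt_pow hm0.ne' (show 1 < q by omega)
      omega
    · exact h
  have lt_n : ∀ {x j : ℕ}, e * x < designBound q m → j ≤ m / 2 → x * q ^ j < n := by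
    intro x j hx hj
    have := mul_pow_lt hq hj hx
    rw [← he, mul_comm n e] at this
    refine Nat.lt_of_mul_lt_mul_left (a := e) (lt_of_le_of_lt ?_ this)
    rw [← mul_assoc]
    exact Nat.mul_le_mul_left _ (by omega)
  have key : ∀ {x y : ℕ}, e * x < designBound q m → e * y < designBound q m → ¬ q ∣ y →
      ∀ j ≤ m / 2, (x : ZMod n) * (q : ZMod n) ^ j = (y : ZMod n) → j = 0 ∧ x = y := by
    intro x y hx hy hyq j hj h
    have h' : ((x * q ^ j : ℕ) : ZMod n) = (y : ℕ) := by push_cast; exact h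
    have hy' := lt_n hy (Nat.zero_le _)
    rw [pow_zero, mul_one] at hy'
    rw [ZMod.natCast_eq_natCast_iff', Nat.mod_eq_of_lt (lt_n hx hj), Nat.mod_eq_of_lt hy'] at h'
    rcases Nat.eq_zero_or_pos j with rfl | hj0
    · exact ⟨rfl, by simpa using h'⟩
    · exact absurd (h' ▸ (dvd_pow_self q hj0.ne').mul_left x) hyq
  rw [← natCast_pow_mod hm] at h
  have hlt := Nat.mod_lt j hm0
  rcases le_or_gt (j % m) (m / 2) with hj | hj
  · have := key hx hy hyq _ hj h
    exact ⟨Nat.dvd_of_mod_eq_zero this.1, this.2⟩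
  · have := key hy hx hxq (m - j % m) (by omega) (by
      rw [← h, mul_assoc, ← pow_add, Nat.add_sub_cancel' hlt.le, hm, mul_one])
    omega

theorem exists_mul_pow_of_pos (hq : 2 ≤ q) {x : ℕ} (hx : 0 < x) :
    ∃ y i, x = y * q ^ i ∧ 0 < y ∧ ¬ q ∣ y := by
  obtain ⟨i, y, hy, rfl⟩ := Nat.exists_eq_pow_mul_and_not_dvd hx.ne' q (by omega)
  exact ⟨y, i, mul_comm _ _, Nat.pos_of_ne_zero (by rintro rfl; simp at hy), hy⟩

theorem card_filter_not_dvd (q d : ℕ) (hq : 2 ≤ q) :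
    ((Finset.Ioc 0 d).filter fun x => ¬ q ∣ x).card = ⌈(d : ℚ) * (1 - 1 / (q : ℚ))⌉₊ := by
  have h1 := Finset.card_filter_add_card_filter_not (s := Finset.Ioc 0 d) (fun x => q ∣ x)
  rw [Nat.Ioc_filter_dvd_card_eq_div, Nat.card_Ioc] at h1
  have hq0 : (0 : ℚ) < q := by exact_mod_cast (by omega : 0 < q)
  have h2 : ((Finset.Ioc 0 d).filter fun x => ¬ q ∣ x).card = d - d / q := by omega
  rw [h2]
  symm
  have hdm : (q : ℚ) * (d / q : ℕ) + (d % q : ℕ) = d := by exact_mod_cast Nat.div_add_mod d q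
  have hlt : ((d % q : ℕ) : ℚ) < q := by exact_mod_cast Nat.mod_lt d (by omega)
  have hge : (0 : ℚ) ≤ ((d % q : ℕ) : ℚ) := by positivity
  have hle : d / q ≤ d := Nat.div_le_self _ _
  have hform : (d : ℚ) * (1 - 1 / (q : ℚ)) = d - (d / q : ℕ) - ((d % q : ℕ) : ℚ) / q := by
    field_simp
    linarith
  have hfrac : ((d % q : ℕ) : ℚ) / q < 1 := by rwa [div_lt_one hq0]
  have hfrac0 : 0 ≤ ((d % q : ℕ) : ℚ) / q := by positivity
  rcases Nat.eq_zero_or_pos (d - d / q) with h0 | hpos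
  · rw [h0, Nat.ceil_eq_zero, hform]
    have : d / q = d := by omega
    rw [this]; linarith
  · rw [Nat.ceil_eq_iff hpos.ne', hform, Nat.cast_sub (by omega), Nat.cast_sub hle]
    constructor <;> push_cast <;> linarith

theorem mem_cosetUnion_mul_iff [NeZero m] (hm : (q : ZMod n) ^ m = 1) (a b : ℕ) (z : ZMod n) :
    z * (q : ZMod n) ∈ cosetUnion q n a b ↔ z ∈ cosetUnion q n a b := by
  constructor
  · rintro ⟨i, ha, hb, j, h⟩
    refine ⟨i, ha, hb, j + (m - 1), ?_⟩
    rw [pow_add, ← mul_assoc, ← h, mul_assoc, ← pow_succ',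
      Nat.sub_add_cancel (NeZero.one_le), hm, mul_one]
  · rintro ⟨i, ha, hb, j, h⟩
    exact ⟨i, ha, hb, j + 1, by rw [h, pow_succ, mul_assoc]⟩

/-- The number of elements of `S_1 ∪ ⋯ ∪ S_d` for small `d`. -/
theorem ncard_cosetUnion_one (hq : 2 ≤ q) (hm : (q : ZMod n) ^ m = 1) (hm0 : 0 < m)
    (he : n * e = q ^ m - 1) {d : ℕ} (hd : e * d < designBound q m) :
    (cosetUnion q n 1 d).ncard = m * ⌈(d : ℚ) * (1 - 1 / (q : ℚ))⌉₊ := by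
  have : NeZero m := ⟨hm0.ne'⟩
  rw [← card_filter_not_dvd q d hq]
  set s := (Finset.Ioc 0 d).filter fun x => ¬ q ∣ x with hs
  have hsm : ∀ x, x ∈ s ↔ (0 < x ∧ x ≤ d) ∧ ¬ q ∣ x := by simp [hs]
  have hb : ∀ x ≤ d, e * x < designBound q m := fun x hx =>
    (Nat.mul_le_mul_left e hx).trans_lt hd
  have himg : cosetUnion q n 1 d =
      (fun w : ℕ × ℕ => (w.1 : ZMod n) * (q : ZMod n) ^ w.2) '' ↑(s ×ˢ Finset.range m) := by
    ext z
    simp only [cosetUnion, cyclotomicCoset, Set.mem_ofPred_eq, Set.mem_image, Finset.mem_coe,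
      Finset.mem_product, Finset.mem_range, Prod.exists, hsm]
    constructor
    · rintro ⟨x, hx0, hxd, j, rfl⟩
      obtain ⟨y, i, rfl, hy0, hy⟩ := exists_mul_pow_of_pos hq hx0
      refine ⟨y, (i + j) % m, ⟨⟨⟨hy0, ?_⟩, hy⟩, Nat.mod_lt _ hm0⟩, ?_⟩
      · exact (Nat.le_mul_of_pos_right y (by positivity)).trans hxd
      · rw [natCast_pow_mod hm, pow_add]
        push_cast
        ring
    · rintro ⟨x, j, ⟨⟨⟨hx0, hxd⟩, -⟩, -⟩, rfl⟩
      exact ⟨x, hx0, hxd, j, rfl⟩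
  rw [himg, Set.InjOn.ncard_image, Set.ncard_coe_finset, Finset.card_product,
    Finset.card_range, mul_comm]
  rintro ⟨x, i⟩ hx ⟨y, j⟩ hy h
  simp only [Finset.mem_coe, Finset.mem_product, Finset.mem_range, hsm] at hx hy
  simp only at h
  have h' : (x : ZMod n) * (q : ZMod n) ^ (i + (m - j)) = y := by
    rw [pow_add, ← mul_assoc, h, mul_assoc, ← pow_add, Nat.add_sub_cancel' hy.2.le, hm, mul_one]
  have := natCast_mul_pow_eq hq hm hm0 he (hb _ hx.1.1.2) (hb _ hy.1.1.2) hx.1.2 hy.1.2 h'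
  obtain ⟨⟨t, ht⟩, hxy⟩ := this
  -- The multiple `i + (m - j)` of `m` lies strictly between `0` and `2m`, so it is `m` and `i = j`.
  have ht1 : t = 1 := by
    have h1 : 0 < m * t := by omega
    have h2 : m * t < m * 2 := by omega
    have := Nat.pos_of_mul_pos_left h1
    have := Nat.lt_of_mul_lt_mul_left h2
    omega
  subst ht1
  simp only [Prod.mk.injEq]
  exact ⟨hxy, by omega⟩

theorem neg_mem_cosetUnion_iff {δ : ℕ} (hδ : 1 ≤ δ) (hδn : δ ≤ n) (z : ZMod n) :
    -z ∈ cosetUnion q n (n - δ + 1) (n - 1) ↔ z ∈ cosetUnion q n 1 (δ - 1) := by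
  have hc : ∀ i ≤ n, ((n - i : ℕ) : ZMod n) = -(i : ZMod n) := by
    intro i hi
    rw [Nat.cast_sub hi]; simp
  constructor
  · rintro ⟨i, ha, hb, j, h⟩
    refine ⟨n - i, by omega, by omega, j, ?_⟩
    rw [hc i (by omega), neg_mul, ← h, neg_neg]
  · rintro ⟨i, ha, hb, j, h⟩
    refine ⟨n - i, by omega, by omega, j, ?_⟩
    rw [hc i (by omega), neg_mul, ← h]

/-- The defining set of `C₂` is the complement of `S_{n-δ+1} ∪ ⋯ ∪ S_{n-1}`. -/
theorem cosetUnion_diff_eq_compl {δ : ℕ} (hn : 0 < n) :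
    cosetUnion q n 0 (n - δ) \ cosetUnion q n (n - δ + 1) (n - 1) =
      (cosetUnion q n (n - δ + 1) (n - 1))ᶜ := by
  have : NeZero n := ⟨hn.ne'⟩
  rw [Set.sdiff_eq, Set.inter_eq_right]
  intro z hz
  have hlt := ZMod.val_lt z
  have hz' : ∀ a b, a ≤ z.val → z.val ≤ b → z ∈ cosetUnion q n a b := fun a b ha hb =>
    ⟨z.val, ha, hb, 0, by simp⟩
  rcases le_or_gt z.val (n - δ) with h | h
  · exact hz' _ _ (Nat.zero_le _) h
  · exact absurd (hz' _ _ h (by omega)) hz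

end Arithmetic

/-! ### Error operators -/

section Errors

variable (p : ℕ) [Fact p.Prime] {F : Type*} [Field F] [Algebra (ZMod p) F]

/-- The additive character `x ↦ ω^{tr x}` of `F`. -/
noncomputable def traceChar : AddChar F ℂ :=
  (ZMod.stdAddChar (N := p)).compAddMonoidHom (Algebra.trace (ZMod p) F).toAddMonoidHom

theorem traceChar_apply (x : F) :
    traceChar p x = ZMod.stdAddChar (N := p) (Algebra.trace (ZMod p) F x) := rfl

theorem exists_traceChar_mul_ne_one [Finite F] {x : F} (hx : x ≠ 0) :
    ∃ s : F, traceChar p (s * x) ≠ 1 := by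
  obtain ⟨y, hy⟩ := Algebra.trace_surjective (ZMod p) F 1
  refine ⟨y * x⁻¹, ?_⟩
  rw [inv_mul_cancel_right₀ hx, traceChar_apply, hy]
  intro h
  exact one_ne_zero (ZMod.injective_stdAddChar (h.trans (AddChar.map_zero_eq_one _).symm))

theorem traceChar_sum {ι : Type*} (s : Finset ι) (f : ι → F) :
    traceChar p (∑ i ∈ s, f i) = ∏ i ∈ s, traceChar p (f i) :=
  map_prod (traceChar p).toMonoidHom (fun i => Multiplicative.ofAdd (f i)) s

theorem hammingNorm_le_symplecticWeight [DecidableEq F] {n : ℕ} (a b : Fin n → F) :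
    hammingNorm a ≤ symplecticWeight a b ∧ hammingNorm b ≤ symplecticWeight a b := by
  constructor
  · exact Finset.card_le_card (Finset.monotone_filter_right _ fun i _ h h' =>
      h (Prod.ext_iff.1 h').1)
  · exact Finset.card_le_card (Finset.monotone_filter_right _ fun i _ h h' =>
      h (Prod.ext_iff.1 h').2)

variable [Fintype F] [DecidableEq F] {n : ℕ}

theorem errorOp_apply (a b y x : Fin n → F) :
    errorOp p a b y x = if y = x + a then traceChar p (b ⬝ᵥ x) else 0 := by
  simp only [errorOp, tensorOp, phaseOp, Matrix.of_apply, Matrix.mul_diagonal, shiftOp, ite_mul,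
    one_mul, zero_mul, ← traceChar_apply]
  rw [Fintype.prod_ite_zero]
  simp only [funext_iff, Pi.add_apply, dotProduct, traceChar_sum]
  congr

theorem errorOp_mulVec_apply (a b : Fin n → F) (ψ : (Fin n → F) → ℂ) (y : Fin n → F) :
    (errorOp p a b *ᵥ ψ) y = traceChar p (b ⬝ᵥ (y - a)) * ψ (y - a) := by
  simp only [Matrix.mulVec, dotProduct, errorOp_apply, ite_mul, zero_mul]
  rw [Finset.sum_eq_single (y - a)]
  · simp
  · intro x _ hx
    rw [if_neg]
    rintro rfl
    simp at hx
  · simp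

theorem errorOp_mul_apply {ι : Type*} (a b : Fin n → F) (V : Matrix (Fin n → F) ι ℂ)
    (y : Fin n → F) (i : ι) :
    (errorOp p a b * V) y i = traceChar p (b ⬝ᵥ (y - a)) * V (y - a) i :=
  errorOp_mulVec_apply p a b (fun x => V x i) y

theorem errorOp_zero_zero : errorOp p (0 : Fin n → F) 0 = 1 := by
  ext y x
  simp [errorOp_apply, Matrix.one_apply]

end Errors

/-! ### Superpositions over cosets -/

section CosetStates

variable (p : ℕ) [Fact p.Prime] {F : Type*} [Field F] [Algebra (ZMod p) F] {n : ℕ} {ι : Type*} {R : Submodule F (Fin n → F)} {u : ι → Fin n → F}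

open Classical in
/-- The matrix whose columns are the normalized coset states `|R|^{-1/2} ∑_{c ∈ R} |u_i + c⟩`. -/
noncomputable def cosetStates (R : Submodule F (Fin n → F)) (u : ι → Fin n → F) :
    Matrix (Fin n → F) ι ℂ :=
  Matrix.of fun y i => if y - u i ∈ R then (((√(Nat.card R) : ℝ) : ℂ))⁻¹ else 0

theorem cosetStates_of_mem {y : Fin n → F} {i : ι} (h : y - u i ∈ R) :
    cosetStates R u y i = (((√(Nat.card R) : ℝ) : ℂ))⁻¹ := if_pos h

theorem cosetStates_of_notMem {y : Fin n → F} {i : ι} (h : y - u i ∉ R) :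
    cosetStates R u y i = 0 := if_neg h

theorem sub_mem_of_cosetStates_ne_zero {y : Fin n → F} {i : ι} (h : cosetStates R u y i ≠ 0) :
    y - u i ∈ R := by
  by_contra h'
  exact h (cosetStates_of_notMem h')

theorem cosetStates_congr {y y' : Fin n → F} {i i' : ι} (h : (y - u i) - (y' - u i') ∈ R) :
    cosetStates R u y i = cosetStates R u y' i' := by
  have : y - u i ∈ R ↔ y' - u i' ∈ R := by
    constructor <;> intro h1
    · simpa using R.sub_mem h1 h
    · simpa using R.add_mem h h1
  by_cases h1 : y - u i ∈ R
  · rw [cosetStates_of_mem h1, cosetStates_of_mem (this.1 h1)]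
  · rw [cosetStates_of_notMem h1, cosetStates_of_notMem (mt this.2 h1)]

theorem cosetStates_add {c : Fin n → F} (hc : c ∈ R) (y : Fin n → F) (i : ι) :
    cosetStates R u (y + c) i = cosetStates R u y i := cosetStates_congr (by
  rwa [show y + c - u i - (y - u i) = c by abel])

theorem star_cosetStates (y : Fin n → F) (i : ι) :
    star (cosetStates R u y i) = cosetStates R u y i := by
  by_cases h : y - u i ∈ R
  · rw [cosetStates_of_mem h, star_inv₀]
    simp
  · rw [cosetStates_of_notMem h, star_zero]

variable [Fintype F]

theorem sqrt_natCard_ne_zero : ((√(Nat.card R) : ℝ) : ℂ) ≠ 0 := by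
  rw [Complex.ofReal_ne_zero, Real.sqrt_ne_zero']
  exact_mod_cast Nat.card_pos

theorem exists_mem_traceChar_ne_one {x : Fin n → F} (hx : x ∉ euclideanDual R) :
    ∃ c ∈ R, traceChar p (c ⬝ᵥ x) ≠ 1 := by
  simp only [mem_euclideanDual, not_forall] at hx
  obtain ⟨c, hc, h⟩ := hx
  obtain ⟨s, hs⟩ := exists_traceChar_mul_ne_one p h
  exact ⟨s • c, R.smul_mem s hc, by rwa [smul_dotProduct, smul_eq_mul]⟩

theorem conjTranspose_cosetStates_mul_self [DecidableEq ι]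
    (hu : ∀ i j, u i - u j ∈ R → i = j) :
    (cosetStates R u)ᴴ * cosetStates R u = 1 := by
  classical
  ext i j
  simp only [Matrix.mul_apply, Matrix.conjTranspose_apply, star_cosetStates]
  rcases eq_or_ne i j with rfl | hij
  · rw [Matrix.one_apply_eq]
    calc ∑ y, cosetStates R u y i * cosetStates R u y i
        = ∑ y, if y - u i ∈ R then ((Nat.card R : ℂ))⁻¹ else 0 := by
          refine Finset.sum_congr rfl fun y _ => ?_
          split_ifs with h
          · rw [cosetStates_of_mem h, ← mul_inv, ← Complex.ofReal_mul,
              Real.mul_self_sqrt (Nat.cast_nonneg _), Complex.ofReal_natCast]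
          · rw [cosetStates_of_notMem h, zero_mul]
      _ = ∑ y, if y ∈ R then ((Nat.card R : ℂ))⁻¹ else 0 :=
          Fintype.sum_equiv (Equiv.subRight (u i)) _ _ fun y => by simp
      _ = 1 := by
          rw [Finset.sum_ite, Finset.sum_const_zero, add_zero, Finset.sum_const, nsmul_eq_mul,
            ← Fintype.card_subtype]
          rw [Nat.card_eq_fintype_card]
          exact mul_inv_cancel₀ (by exact_mod_cast Fintype.card_ne_zero)
  · rw [Matrix.one_apply_ne hij]
    refine Finset.sum_eq_zero fun y _ => ?_
    by_contra h
    have h1 := sub_mem_of_cosetStates_ne_zero (left_ne_zero_of_mul h)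
    have h2 := sub_mem_of_cosetStates_ne_zero (right_ne_zero_of_mul h)
    refine hij (hu i j ?_)
    simpa using R.sub_mem h2 h1

variable [DecidableEq F]

theorem conjTranspose_mul_errorOp_mul_cosetStates_apply (a b : Fin n → F) (i j : ι) :
    ((cosetStates R u)ᴴ * errorOp p a b * cosetStates R u) i j =
      ∑ y, cosetStates R u y i *
        (traceChar p (b ⬝ᵥ (y - a)) * cosetStates R u (y - a) j) := by
  rw [Matrix.mul_assoc, Matrix.mul_apply]
  simp only [Matrix.conjTranspose_apply, star_cosetStates, errorOp_mul_apply]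

/-- All coset states are supported in `R^⊥`, and translation by `a ∉ R^⊥` moves that support off
itself. -/
theorem conjTranspose_mul_errorOp_mul_cosetStates_of_shift
    (hu : ∀ i, u i ∈ euclideanDual R) (hR : R ≤ euclideanDual R) {a : Fin n → F}
    (b : Fin n → F) (ha : a ∉ euclideanDual R) :
    (cosetStates R u)ᴴ * errorOp p a b * cosetStates R u = 0 := by
  ext i j
  rw [conjTranspose_mul_errorOp_mul_cosetStates_apply, Matrix.zero_apply]
  refine Finset.sum_eq_zero fun y _ => ?_
  by_contra h
  have h1 := hR (sub_mem_of_cosetStates_ne_zero (left_ne_zero_of_mul h))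
  have h2 := hR (sub_mem_of_cosetStates_ne_zero
    (right_ne_zero_of_mul (right_ne_zero_of_mul h)))
  apply ha
  have h3 := Submodule.add_mem _ (Submodule.sub_mem _ h1 h2) (Submodule.sub_mem _ (hu i) (hu j))
  rwa [show y - u i - (y - a - u j) + (u i - u j) = a by abel] at h3

theorem conjTranspose_mul_errorOp_mul_cosetStates_of_phase
    (a : Fin n → F) {b : Fin n → F} (hb : b ∉ euclideanDual R) :
    (cosetStates R u)ᴴ * errorOp p a b * cosetStates R u = 0 := by
  obtain ⟨c, hc, hne⟩ := exists_mem_traceChar_ne_one p hb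
  ext i j
  rw [conjTranspose_mul_errorOp_mul_cosetStates_apply, Matrix.zero_apply]
  set S := ∑ y, cosetStates R u y i *
        (traceChar p (b ⬝ᵥ (y - a)) * cosetStates R u (y - a) j) with hS
  -- Translating the summation variable by `c ∈ R` fixes the coset states and multiplies the sum by
  -- a character value different from `1`.
  have h : S = traceChar p (c ⬝ᵥ b) * S := by
    conv_rhs => rw [hS, Finset.mul_sum]
    rw [hS]
    symm
    refine Fintype.sum_equiv (Equiv.addRight c) _ _ fun y => ?_
    rw [Equiv.coe_addRight, cosetStates_add hc, show y + c - a = y - a + c by abel,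
      cosetStates_add hc, dotProduct_add, AddChar.map_add_eq_mul, dotProduct_comm b c]
    ring
  by_contra hS0
  exact hne (mul_right_cancel₀ hS0 (by rw [one_mul]; exact h.symm))

/-- Invariance under all `Z(b)` confines the support of `ψ` to `R^⊥`; invariance under all `X(a)`
makes `ψ` constant on cosets of `R`. -/
theorem errorOp_mulVec_eq_self_iff [Fintype ι]
    (hu : ∀ i, u i ∈ euclideanDual R) (hR : R ≤ euclideanDual R)
    (hinj : ∀ i j, u i - u j ∈ R → i = j) (hsurj : ∀ y ∈ euclideanDual R, ∃ i, y - u i ∈ R)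
    (ψ : (Fin n → F) → ℂ) :
    (∃ φ, ψ = cosetStates R u *ᵥ φ) ↔ ∀ a ∈ R, ∀ b ∈ R, errorOp p a b *ᵥ ψ = ψ := by
  constructor
  · rintro ⟨φ, rfl⟩ a ha b hb
    rw [Matrix.mulVec_mulVec]
    congr 1
    ext y i
    rw [errorOp_mul_apply, sub_eq_add_neg, cosetStates_add (R.neg_mem ha), ← sub_eq_add_neg]
    by_cases h : cosetStates R u y i = 0
    · rw [h, mul_zero]
    · have h1 : y - a ∈ euclideanDual R := by
        have h2 := hR (R.sub_mem (sub_mem_of_cosetStates_ne_zero h) ha)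
        have h3 := Submodule.add_mem _ h2 (hu i)
        rwa [show y - u i - a + u i = y - a by abel] at h3
      rw [h1 b hb, AddChar.map_zero_eq_one, one_mul]
  · intro hψ
    refine ⟨fun i => ((√(Nat.card R) : ℝ) : ℂ) * ψ (u i), ?_⟩
    ext y
    rw [Matrix.mulVec, dotProduct]
    by_cases hy : y ∈ euclideanDual R
    · obtain ⟨i, hi⟩ := hsurj y hy
      rw [Finset.sum_eq_single i]
      · rw [cosetStates_of_mem hi, inv_mul_cancel_left₀ sqrt_natCard_ne_zero]
        have := congrFun (hψ _ hi 0 R.zero_mem) y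
        rw [errorOp_mulVec_apply] at this
        simpa using this.symm
      · intro j _ hj
        rw [cosetStates_of_notMem, zero_mul]
        intro h
        refine hj (hinj j i ?_)
        simpa using R.sub_mem hi h
      · simp
    · rw [Finset.sum_eq_zero]
      · obtain ⟨c, hc, hne⟩ := exists_mem_traceChar_ne_one p hy
        have := congrFun (hψ 0 R.zero_mem c hc) y
        rw [errorOp_mulVec_apply, sub_zero] at this
        by_contra h0
        exact hne (mul_right_cancel₀ h0 (by rw [one_mul]; exact this))
      · intro i _
        rw [cosetStates_of_notMem, zero_mul]
        intro h
        apply hy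
        simpa using Submodule.add_mem _ (hR h) (hu i)

end CosetStates

/-! ### The Euclidean construction -/

section Construction

/-- The representatives are the elements of a linear complement of `R` in `C`. -/
theorem exists_coset_representatives {F V : Type*} [Field F] [Fintype F] [AddCommGroup V]
    [Module F V] [FiniteDimensional F V] {R C : Submodule F V} (h : R ≤ C) {s : ℕ}
    (hs : Module.finrank F C = Module.finrank F R + s) :
    ∃ g : Fin (Fintype.card F ^ s) → V, (∀ w, g w ∈ C) ∧ (∀ c ∈ C, ∃ w, c - g w ∈ R) ∧
      ∀ w w', g w - g w' ∈ R → w = w' := by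
  obtain ⟨W, hW, hsup⟩ := IsModularLattice.exists_disjoint_and_sup_eq h
  have hrank : Module.finrank F W = s := by
    have h1 := Submodule.finrank_sup_add_finrank_inf_eq R W
    rw [hsup, hW.eq_bot, finrank_bot] at h1
    omega
  have : Finite V := Module.finite_of_finite F
  have : Fintype W := Fintype.ofFinite W
  have e : W ≃ Fin (Fintype.card F ^ s) :=
    Fintype.equivFinOfCardEq (by rw [Module.card_eq_pow_finrank (K := F), hrank])
  refine ⟨fun w => e.symm w, fun w => hsup ▸ (le_sup_right : W ≤ R ⊔ W) (e.symm w).2, ?_, ?_⟩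
  · intro c hc
    rw [← hsup] at hc
    obtain ⟨x, hx, w, hw, rfl⟩ := Submodule.mem_sup.1 hc
    exact ⟨e ⟨w, hw⟩, by simpa using hx⟩
  · intro w w' hw
    have := Submodule.disjoint_def.1 hW _ hw (W.sub_mem (e.symm w).2 (e.symm w').2)
    exact e.symm.injective (Subtype.ext (sub_eq_zero.1 this))

/-- A code `C` whose radical `C ∩ C^⊥` has dual distance at least `d` gives a subsystem code. -/
theorem exists_isSubsystemCode_isEuclideanConstruction (p : ℕ) [Fact p.Prime] {F : Type*}
    [Field F] [Fintype F] [DecidableEq F] [Algebra (ZMod p) F] {n k l r d : ℕ}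
    (C : Submodule F (Fin n → F)) (hC : Module.finrank F C = k + r)
    (hR : Module.finrank F (C ⊓ euclideanDual C : Submodule F (Fin n → F)) = k)
    (hl : 2 * k + l + r = n)
    (hd : ∀ x ∈ euclideanDual (C ⊓ euclideanDual C), x ≠ 0 → d ≤ hammingNorm x) :
    ∃ V : Matrix (Fin n → F) (Fin (Fintype.card F ^ l) × Fin (Fintype.card F ^ r)) ℂ,
      IsSubsystemCode p n l r d V ∧ IsEuclideanConstruction p C V := by
  set R := C ⊓ euclideanDual C with hRdef
  have hRC : R ≤ C := inf_le_left
  have hRC' : R ≤ euclideanDual C := inf_le_right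
  have hdual : euclideanDual R = C ⊔ euclideanDual C := euclideanDual_inf_euclideanDual C
  have hCd : C ≤ euclideanDual R := hdual ▸ le_sup_left
  have hCd' : euclideanDual C ≤ euclideanDual R := hdual ▸ le_sup_right
  have hRR : R ≤ euclideanDual R := hRC.trans hCd
  obtain ⟨f, hfC, hfs, hfi⟩ := exists_coset_representatives hRC' (s := l)
    (by rw [finrank_euclideanDual, hC, hR]; omega)
  obtain ⟨g, hgC, hgs, hgi⟩ := exists_coset_representatives hRC (s := r) (by rw [hC, hR])
  set u : Fin (Fintype.card F ^ l) × Fin (Fintype.card F ^ r) → Fin n → F :=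
    fun i => f i.1 + g i.2 with hudef
  have hu : ∀ i, u i ∈ euclideanDual R := fun i =>
    Submodule.add_mem _ (hCd' (hfC _)) (hCd (hgC _))
  have hinj : ∀ i j, u i - u j ∈ R → i = j := by
    rintro ⟨s, w⟩ ⟨s', w'⟩ h
    have h' : (f s + g w) - (f s' + g w') ∈ R := h
    -- The difference lies in `C`, and also in `C^⊥` because the `f` part does.
    have hg : g w - g w' ∈ R := by
      refine ⟨C.sub_mem (hgC w) (hgC w'), ?_⟩
      have h1 := Submodule.sub_mem _ (hRC' h') (Submodule.sub_mem _ (hfC s) (hfC s'))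
      rwa [show (f s + g w) - (f s' + g w') - (f s - f s') = g w - g w' by abel] at h1
    have hf : f s - f s' ∈ R := by
      have h1 := R.sub_mem h' hg
      rwa [show (f s + g w) - (f s' + g w') - (g w - g w') = f s - f s' by abel] at h1
    rw [hfi _ _ hf, hgi _ _ hg]
  have hsurj : ∀ y ∈ euclideanDual R, ∃ i, y - u i ∈ R := by
    intro y hy
    rw [hdual] at hy
    obtain ⟨c, hc, c', hc', rfl⟩ := Submodule.mem_sup.1 hy
    obtain ⟨w, hw⟩ := hgs c hc
    obtain ⟨s, hs⟩ := hfs c' hc'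
    refine ⟨(s, w), ?_⟩
    have h1 := R.add_mem hw hs
    rwa [show c - g w + (c' - f s) = c + c' - u (s, w) by simp only [hudef]; abel] at h1
  refine ⟨cosetStates R u, ⟨conjTranspose_cosetStates_mul_self hinj, fun a b hab => ?_⟩,
    ⟨errorOp_mulVec_eq_self_iff p hu hRR hinj hsurj, fun a ha b hb => ?_⟩⟩
  · by_cases ha : a ∈ euclideanDual R
    · by_cases hb : b ∈ euclideanDual R
      · have hwt := hammingNorm_le_symplecticWeight a b
        have ha0 : a = 0 := by
          by_contra h0
          have := hd a ha h0
          omega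
        have hb0 : b = 0 := by
          by_contra h0
          have := hd b hb h0
          omega
        refine ⟨1, ?_⟩
        rw [ha0, hb0, errorOp_zero_zero, Matrix.mul_one, conjTranspose_cosetStates_mul_self hinj,
          Matrix.one_kronecker_one]
      · exact ⟨0, by
          rw [conjTranspose_mul_errorOp_mul_cosetStates_of_phase p a hb, Matrix.kronecker_zero]⟩
    · exact ⟨0, by
        rw [conjTranspose_mul_errorOp_mul_cosetStates_of_shift p hu hRR b ha,
          Matrix.kronecker_zero]⟩
  · have hex : ∀ w, ∃ w', g w + a - g w' ∈ R := fun w => hgs _ (C.add_mem (hgC w) ha)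
    choose t ht using hex
    -- `X(a)` only permutes the labels in `C/R`. The phase of `Z(b)` depends only on `g w`, since
    -- `R` and the `f s` lie in `C^⊥` and `b ∈ C`.
    refine ⟨Matrix.of fun w' w => if w' = t w then traceChar p (b ⬝ᵥ g w) else 0, ?_⟩
    ext y ⟨s, w⟩
    rw [errorOp_mul_apply, Matrix.mul_apply, Finset.sum_eq_single (s, t w)]
    · have h1 : cosetStates R u (y - a) (s, w) = cosetStates R u y (s, t w) := by
        refine cosetStates_congr ?_
        have h2 := R.neg_mem (ht w)
        rwa [show -(g w + a - g (t w)) = y - a - u (s, w) - (y - u (s, t w)) by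
          simp only [hudef]; abel] at h2
      rw [h1, Matrix.kroneckerMap_apply, Matrix.one_apply_eq, Matrix.of_apply, if_pos rfl, one_mul,
        mul_comm]
      by_cases h : cosetStates R u y (s, t w) = 0
      · rw [h, zero_mul, zero_mul]
      · rw [← h1] at h
        have h2 : y - a - g w ∈ euclideanDual C := by
          have h3 := Submodule.add_mem _ (hRC' (sub_mem_of_cosetStates_ne_zero h)) (hfC s)
          rwa [show y - a - u (s, w) + f s = y - a - g w by simp only [hudef]; abel] at h3
        rw [← sub_add_cancel (y - a) (g w), dotProduct_add, h2 b hb, zero_add]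
    · rintro ⟨s', w'⟩ _ hne
      rw [Matrix.kroneckerMap_apply, Matrix.of_apply, Matrix.one_apply]
      by_cases hs : s' = s
      · rw [if_neg (c := w' = t w) fun hw => hne (by rw [hs, hw]), mul_zero, mul_zero]
      · rw [if_neg hs, zero_mul, mul_zero]
    · simp

end Construction

/-! ### The bound on the designed distance, and the main theorem -/

theorem mul_sub_one_lt_designBound {q n m δ e : ℕ} (hq : 2 ≤ q) (hm0 : 0 < m) (he0 : 0 < e)
    (he : n * e = q ^ m - 1) (hδ : 2 ≤ δ)
    (hδmax : (δ : ℚ) ≤ (n : ℚ) / ((q : ℚ) ^ m - 1) *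
      ((q : ℚ) ^ ((m + 1) / 2) - 1 - (if Odd m then (q : ℚ) - 2 else 0))) :
    e * (δ - 1) < designBound q m ∧ δ ≤ n := by
  have h1 : q ≤ q ^ ((m + 1) / 2) := Nat.le_self_pow (by omega) q
  have h2 : q ^ ((m + 1) / 2) ≤ q ^ m := Nat.pow_le_pow_right (by omega) (by omega)
  have hqm : 1 < q ^ m := Nat.one_lt_pow hm0.ne' (by omega)
  have hcast : ((designBound q m : ℕ) : ℚ) =
      (q : ℚ) ^ ((m + 1) / 2) - 1 - (if Odd m then (q : ℚ) - 2 else 0) := by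
    unfold designBound
    split_ifs
    · rw [Nat.cast_sub (by omega), Nat.cast_sub (by omega), Nat.cast_sub hq]
      push_cast; ring
    · rw [Nat.sub_zero, Nat.cast_sub (by omega)]
      push_cast; ring
  have hne : (n : ℚ) * e = (q : ℚ) ^ m - 1 := by
    have : ((n * e : ℕ) : ℚ) = ((q ^ m - 1 : ℕ) : ℚ) := by rw [he]
    rw [Nat.cast_sub hqm.le] at this
    push_cast at this
    exact this
  have hn0 : 0 < n := Nat.pos_of_ne_zero (by rintro rfl; omega)
  have hn0' : (n : ℚ) ≠ 0 := by exact_mod_cast hn0.ne'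
  have he0' : (0 : ℚ) < e := by exact_mod_cast he0
  -- Since `n e = q^m - 1`, the bound `δ_max` equals `designBound q m / e`.
  rw [← hcast, ← hne, ← div_div, div_self hn0', one_div, inv_mul_eq_div, le_div_iff₀ he0'] at hδmax
  have hle : δ * e ≤ designBound q m := by exact_mod_cast hδmax
  constructor
  · refine lt_of_lt_of_le ?_ hle
    rw [mul_comm δ e]
    exact Nat.mul_lt_mul_of_pos_left (by omega) he0
  · refine Nat.le_of_mul_le_mul_right (hle.trans ?_) he0
    rw [he]
    unfold designBound
    omega

end SubsystemBCH

open SubsystemBCH in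
theorem mainTheorem4 (p : ℕ) [Fact p.Prime] {F : Type*} [Field F] [Fintype F] [DecidableEq F]
    [Algebra (ZMod p) F] {L : Type*} [Field L] [Algebra F L]
    (q n m δ : ℕ) (hq : q = Fintype.card F) (hqn : Nat.gcd n q = 1)
    (hm : m = orderOf (q : ZMod n)) (hn : q ^ (m / 2) < n) (hn' : n ≤ q ^ m - 1)
    (hδ : 2 ≤ δ)
    (hδmax : (δ : ℚ) ≤ (n : ℚ) / ((q : ℚ) ^ m - 1) *
      ((q : ℚ) ^ ((m + 1) / 2) - 1 - (if Odd m then (q : ℚ) - 2 else 0)))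
    (α : L) (hα : IsPrimitiveRoot α n)
    (C₁ C₂ : Submodule F (Fin n → F)) (TC₂ T : Set (ZMod n))
    (hTC₂ : TC₂ = SubsystemBCH.cosetUnion q n 0 (n - δ) \
      SubsystemBCH.cosetUnion q n (n - δ + 1) (n - 1))
    (hC₂ : C₂ = SubsystemBCH.cyclicCode F α TC₂)
    (hTne : T.Nonempty)
    (hTcosets : ∀ t ∈ T, SubsystemBCH.cyclotomicCoset q n t ⊆ T)
    (hT : T ⊆ {0} ∪ (SubsystemBCH.cosetUnion q n δ (n - δ) \
      (SubsystemBCH.cosetUnion q n 1 (δ - 1) ∪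
        SubsystemBCH.cosetUnion q n (n - δ + 1) (n - 1))))
    (hC₁ : C₁ = SubsystemBCH.cyclicCode F α (TC₂ \ (T ∪ {t | -t ∈ T})))
    (k r : ℕ) (hk : k = m * ⌈((δ : ℚ) - 1) * (1 - 1 / (q : ℚ))⌉₊)
    (hr : r = (T ∪ {t | -t ∈ T}).ncard) :
    C₂ ≤ SubsystemBCH.euclideanDual C₂ ∧
    C₁ ⊓ SubsystemBCH.euclideanDual C₁ = C₂ ∧
    (r < n - 2 * k → ∃ d : ℕ, δ ≤ d ∧
      ∃ V : Matrix (Fin n → F)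
          (Fin (Fintype.card F ^ (n - 2 * k - r)) × Fin (Fintype.card F ^ r)) ℂ,
        SubsystemBCH.IsSubsystemCode p n (n - 2 * k - r) r d V ∧
        SubsystemBCH.IsEuclideanConstruction p C₁ V) := by
  have hq2 : 2 ≤ q := hq ▸ Fintype.one_lt_card
  have hn1 : 1 < n := (Nat.one_le_pow _ _ (by omega)).trans_lt hn
  have : NeZero n := ⟨by omega⟩
  have hunit : IsUnit (q : ZMod n) := (ZMod.isUnit_iff_coprime q n).2 (Nat.Coprime.symm hqn)
  have hm0 : 0 < m := hm ▸ hunit.isOfFinOrder.orderOf_pos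
  have : NeZero m := ⟨hm0.ne'⟩
  have hqm : (q : ZMod n) ^ m = 1 := hm ▸ pow_orderOf_eq_one _
  obtain ⟨e, he⟩ : n ∣ q ^ m - 1 := by
    rw [← ZMod.natCast_eq_zero_iff, Nat.cast_sub (Nat.one_le_pow _ _ (by omega))]
    simp [hqm]
  have he0 : 0 < e := Nat.pos_of_ne_zero (by rintro rfl; omega)
  obtain ⟨hb, hδn⟩ := mul_sub_one_lt_designBound hq2 hm0 he0 he.symm hδ hδmax
  set U := cosetUnion q n (n - δ + 1) (n - 1) with hU
  have hneg : ∀ z, -z ∈ U ↔ z ∈ cosetUnion q n 1 (δ - 1) :=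
    neg_mem_cosetUnion_iff (by omega) hδn
  have hTU : TC₂ = Uᶜ := hTC₂.trans (cosetUnion_diff_eq_compl (by omega))
  have hUq : ∀ z, z * (q : ZMod n) ∈ U ↔ z ∈ U := mem_cosetUnion_mul_iff hqm _ _
  have hdisj : ∀ z ∈ U, -z ∉ U := by
    intro z hz hz'
    rw [hneg] at hz'
    rw [← neg_neg z, hneg] at hz
    obtain ⟨x, hx1, hxd, i, hx⟩ := hz
    obtain ⟨y, hy1, hyd, j, hy⟩ := hz'
    have hxb := (Nat.mul_le_mul_left e hxd).trans_lt hb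
    have hyb := (Nat.mul_le_mul_left e hyd).trans_lt hb
    have hjm : j ≤ j * m := Nat.le_mul_of_pos_right j hm0
    -- From `x q^i = -z` and `y q^j = z`; the exponent `jm - j` stands for `-j`, because `q^(jm) =
    -- 1`.
    refine natCast_mul_pow_ne_neg hq2 hqm hm0 he.symm hx1 hy1 hxb hyb (i + (j * m - j)) ?_
    rw [pow_add, ← mul_assoc, ← hx, hy, neg_mul, mul_assoc, ← pow_add,
      Nat.add_sub_cancel' hjm, mul_comm j m, pow_mul, hqm, one_pow, mul_one]
  have hUcard : U.ncard = k := by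
    have h1 : U = (fun z => -z) '' cosetUnion q n 1 (δ - 1) := by
      ext z
      rw [Set.image_neg_eq_neg, Set.mem_neg, ← hneg, neg_neg]
    rw [h1, Set.ncard_image_of_injective _ neg_injective,
      ncard_cosetUnion_one hq2 hqm hm0 he.symm hb, hk, Nat.cast_sub (by omega), Nat.cast_one]
  have hnU : ∀ z ∈ T, z ∉ U ∧ -z ∉ U := by
    intro z hz
    rcases hT hz with h0 | h
    · rw [Set.mem_singleton_iff] at h0
      subst h0
      -- `0` is its own negative, so disjointness of `U` and `-U` excludes it.
      have : (0 : ZMod n) ∉ U := fun h => hdisj 0 h (by rwa [neg_zero])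
      exact ⟨this, by rwa [neg_zero]⟩
    · exact ⟨fun h' => h.2 (Or.inr h'), fun h' => h.2 (Or.inl ((hneg z).1 h'))⟩
  set S := T ∪ {t | -t ∈ T} with hS
  have hSU : ∀ z ∈ S, z ∉ U := by
    rintro z (hz | hz)
    · exact (hnU z hz).1
    · simpa using (hnU _ hz).2
  have hSneg : ∀ z, -z ∈ S ↔ z ∈ S := by
    intro z
    show (-z ∈ T ∨ - -z ∈ T) ↔ (z ∈ T ∨ -z ∈ T)
    rw [neg_neg, or_comm]
  have hTq : ∀ z, z * (q : ZMod n) ∈ T ↔ z ∈ T := by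
    refine fun z => ⟨fun h => hTcosets _ h ⟨m - 1, ?_⟩, fun h => hTcosets _ h ⟨1, by simp⟩⟩
    rw [mul_assoc, ← pow_succ', Nat.sub_add_cancel hm0, hqm, mul_one]
  have hSq : ∀ z, z * (q : ZMod n) ∈ S ↔ z ∈ S := by
    intro z
    show (z * (q : ZMod n) ∈ T ∨ -(z * (q : ZMod n)) ∈ T) ↔ (z ∈ T ∨ -z ∈ T)
    rw [← neg_mul, hTq, hTq]
  clear_value S
  have hZ₁ : TC₂ \ S = (U ∪ S)ᶜ := by
    rw [hTU, Set.compl_union, Set.sdiff_eq]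
  subst hq
  obtain ⟨hr₂, hd₂⟩ := finrank_cyclicCode_and_euclideanDual (F := F) hα hunit TC₂ (by
    intro z
    rw [hTU, Set.mem_compl_iff, Set.mem_compl_iff, hUq])
  obtain ⟨hr₁, hd₁⟩ := finrank_cyclicCode_and_euclideanDual (F := F) hα hunit (TC₂ \ S) (by
    intro z
    rw [hZ₁, Set.mem_compl_iff, Set.mem_compl_iff, Set.mem_union, Set.mem_union, hUq, hSq])
  rw [← hC₂] at hr₂ hd₂
  rw [← hC₁] at hr₁ hd₁
  have hinf : C₁ ⊓ euclideanDual C₁ = C₂ := by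
    rw [hd₁, hC₁, hC₂, cyclicCode_inf]
    congr 1
    ext z
    simp only [hTU, Set.mem_sdiff, Set.mem_union, Set.mem_compl_iff, Set.mem_ofPred_eq, hSneg]
    have h1 := hSU z
    have h2 := hdisj (-z)
    rw [neg_neg] at h2
    tauto
  have hUn : U.ncard ≤ n := by
    simpa [Set.ncard_univ] using Set.ncard_le_ncard (Set.subset_univ U)
  have hUSn : (U ∪ S).ncard ≤ n := by
    simpa [Set.ncard_univ] using Set.ncard_le_ncard (Set.subset_univ (U ∪ S))
  have hUS : (U ∪ S).ncard = k + r := by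
    rw [Set.ncard_union_eq (Set.disjoint_left.2 fun z hz hz' => hSU z hz' hz), hUcard, hr]
  have hk₂ : Module.finrank F C₂ = k := by
    rw [hr₂, hTU, Set.ncard_compl, Nat.card_zmod]
    omega
  have hk₁ : Module.finrank F C₁ = k + r := by
    rw [hr₁, hZ₁, Set.ncard_compl, Nat.card_zmod]
    omega
  refine ⟨?_, hinf, fun hlt => ⟨δ, le_rfl, ?_⟩⟩
  · rw [hd₂, hC₂]
    refine cyclicCode_anti α fun z hz => ?_
    have hz' : -z ∈ U := by simpa [hTU] using hz
    rw [hTU]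
    simpa using hdisj _ hz'
  -- The hypothesis `r < n - 2k` makes the truncated subtraction `n - 2k - r` exact.
  · refine exists_isSubsystemCode_isEuclideanConstruction p C₁ hk₁ (hinf ▸ hk₂) (by omega) ?_
    rw [hinf, hd₂]
    intro x hx hx0
    refine le_hammingNorm_of_mem_cyclicCode hα (fun i hi hid => ?_) hx hx0
    show -(i : ZMod n) ∉ TC₂
    rw [hTU, Set.mem_compl_iff, not_not, hneg]
    exact ⟨i, hi, by omega, 0, by simp⟩
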